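/- For a set $A \subseteq \mathbb{R}^d$ let $\dim_H(A)$ denote its Hausdorff dimension, and let its Fourier dimension be $$\dim_F(A) = \sup\Big\{ s \in [0,d] : \sup_{\xi \in \mathbb{R}^d} |\widehat{\mu}(\xi)|^2 |\xi|^s < \infty \text{ for some } \mu \in \mathcal{M}(A) \Big\},$$ where $\mathcal{M}(A)$ is the set of all non-zero finite Borel measures on $\mathbb{R}^d$ with compact support contained in $A$, and $\widehat{\mu}(\xi) = \int e^{-2\pi i x\cdot\xi}\,d\mu(x)$. Theorem. Let $R \subseteq (0,\infty)$ and $Y, Z \subseteq \mathbb{R}^d$ be non-empty compact sets, and write $RY = \{ry : r \in R,\ y \in Y\}$ and $RY+Z = \{ry + z : r \in R,\ y \in Y,\ z \in Z\}$. If $$\max\{\dim_F(RY)+\dim_H(Z),\ \dim_H(RY)+\dim_F(Z)\} \leq d,$$ then $$\dim_H(RY+Z) \geq \max\{\dim_F(RY)+\dim_H(Z),\ \dim_H(RY)+\dim_F(Z)\}.$$ -/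

import Mathlib

open MeasureTheory
open scoped Pointwise NNReal ENNReal

noncomputable section

/-- The Fourier transform `ξ ↦ ∫ exp (-2πi ⟪x, ξ⟫) dμ(x)` of a measure on `ℝ^d`. -/
def measureFourier {d : ℕ} (μ : Measure (EuclideanSpace ℝ (Fin d)))
    (ξ : EuclideanSpace ℝ (Fin d)) : ℂ :=
  ∫ x, Complex.exp (-2 * Real.pi * Complex.I * (inner ℝ x ξ : ℝ)) ∂μ

/-- The set `ℳ(A)` of all non-zero finite Borel measures on `ℝ^d` with compact support
contained in `A`. -/
def compactlySupportedMeasures {d : ℕ} (A : Set (EuclideanSpace ℝ (Fin d))) :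
    Set (Measure (EuclideanSpace ℝ (Fin d))) :=
  {μ | μ ≠ 0 ∧ IsFiniteMeasure μ ∧ IsCompact μ.support ∧ μ.support ⊆ A}

/-- The Fourier dimension of a set `A ⊆ ℝ^d`: the supremum of all `s ∈ [0, d]` such that
`|μ̂(ξ)|² |ξ|^s` is bounded in `ξ` for some `μ ∈ ℳ(A)`. -/
def dimF {d : ℕ} (A : Set (EuclideanSpace ℝ (Fin d))) : ℝ≥0∞ :=
  sSup {t : ℝ≥0∞ | ∃ s : ℝ≥0, t = s ∧ s ≤ d ∧ ∃ μ ∈ compactlySupportedMeasures A,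
    ∃ C : ℝ, ∀ ξ : EuclideanSpace ℝ (Fin d), ‖measureFourier μ ξ‖ ^ 2 * ‖ξ‖ ^ (s : ℝ) ≤ C}

end

/-! Only compactness of `A = R • Y` matters, and the two halves of the maximum follow from one
inequality by exchanging `A` and `Z`. For a measure `μ` on `A` with `|μ̂(ξ)|² ≲ |ξ|^{-s}` and a
Frostman-type measure `ν` on `Z` of exponent `t`, the convolution `μ ∗ ν` lives on `A + Z`, and it
suffices to show that it has exponent `s + t`.

Regularity is measured by the Gaussian energies `E_μ(r) = ∬ exp(-π|x-y|²/r²) dμ dμ`, so that no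
singular kernel needs a Fourier transform: Fubini gives `E_μ(r) = ∫ w_r |μ̂|²` with a Gaussian
weight `w_r`. Up to a constant, `|ξ|^{-s}` is at most the superposition `∫ ρ^{s-1} exp(-πρ²|ξ|²)
dρ`, and multiplying `w_r` by such a Gaussian gives a multiple of `w_R`, `R = √(r² + ρ²)`. Hence
`E_{μ∗ν}(r)` is at most an average of energies `E_ν(R)`, which is `≲ r^{s+t}` when `s + t < d`
(`gaussEnergy_conv_le`).

Decay `r^u` of the energy bounds the dimension below by every `v < u`, by the mass distribution
principle (`le_dimH_of_gaussEnergy_le`). The measure `ν` comes from Hahn-Banach and Riesz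
representation (`exists_measure_gaussEnergy_le`); a Vitali covering argument supplies the required
nondegeneracy. -/

/-! ### Gaussian energies on the Fourier side -/

/-- The Gaussian `x ↦ exp (-π ‖x‖² / r²)` of width `r`. -/
noncomputable def gaussKernel {V : Type*} [Norm V] (r : ℝ) (x : V) : ℝ :=
  Real.exp (-Real.pi * ‖x‖ ^ 2 / r ^ 2)

/-- The energy of a measure with respect to the Gaussian kernel of width `r`. -/
noncomputable def gaussEnergy {V : Type*} [NormedAddCommGroup V] [MeasurableSpace V]
    (μ : Measure V) (r : ℝ) : ℝ≥0∞ :=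
  ∫⁻ x, ∫⁻ y, ENNReal.ofReal (gaussKernel r (x - y)) ∂μ ∂μ

lemma gaussKernel_nonneg {V : Type*} [Norm V] (r : ℝ) (x : V) : 0 ≤ gaussKernel r x :=
  (Real.exp_pos _).le

lemma gaussKernel_le_one {V : Type*} [NormedAddCommGroup V] (r : ℝ) (x : V) :
    gaussKernel r x ≤ 1 := by
  unfold gaussKernel
  rw [Real.exp_le_one_iff]
  have : 0 ≤ Real.pi * ‖x‖ ^ 2 / r ^ 2 := by positivity
  rw [neg_mul, neg_div]; linarith

@[fun_prop]
lemma continuous_gaussKernel {V : Type*} [NormedAddCommGroup V] (r : ℝ) :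
    Continuous (gaussKernel r : V → ℝ) := by
  unfold gaussKernel; fun_prop

/-- The Fourier weight `ξ ↦ r^d exp (-π r² ‖ξ‖²)` of the Gaussian of width `r`. -/
noncomputable def gaussWeight {d : ℕ} (r : ℝ) (ξ : EuclideanSpace ℝ (Fin d)) : ℝ :=
  r ^ d * Real.exp (-Real.pi * r ^ 2 * ‖ξ‖ ^ 2)

lemma integrable_gaussWeight {d : ℕ} {r : ℝ} (hr : 0 < r) :
    Integrable (gaussWeight r : EuclideanSpace ℝ (Fin d) → ℝ) := by
  have := (GaussianFourier.integrable_cexp_neg_mul_sq_norm_add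
    (b := (Real.pi * r ^ 2 : ℝ)) (by rw [Complex.ofReal_re]; positivity) 0
      (0 : EuclideanSpace ℝ (Fin d))).norm
  unfold gaussWeight
  refine (this.congr ?_).const_mul _
  filter_upwards with ξ
  rw [Complex.norm_exp]
  congr 1
  simp [← Complex.ofReal_pow]

lemma gaussKernel_eq_integral {d : ℕ} {r : ℝ} (hr : 0 < r) (z : EuclideanSpace ℝ (Fin d)) :
    (gaussKernel r z : ℂ) = ∫ ξ : EuclideanSpace ℝ (Fin d), (gaussWeight r ξ : ℂ) *
      Complex.exp (-2 * Real.pi * Complex.I * (inner ℝ z ξ : ℝ)) := by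
  have h := GaussianFourier.integral_cexp_neg_mul_sq_norm_add
    (b := (Real.pi * r ^ 2 : ℝ)) (by rw [Complex.ofReal_re]; positivity) (-2 * Real.pi * Complex.I) z
  have hpi : (Real.pi : ℂ) ≠ 0 := by simp [Real.pi_ne_zero]
  have hr' : (r : ℂ) ≠ 0 := by simp [hr.ne']
  have e : ∀ ξ : EuclideanSpace ℝ (Fin d), (gaussWeight r ξ : ℂ) *
      Complex.exp (-2 * Real.pi * Complex.I * (inner ℝ z ξ : ℝ)) = (r : ℂ) ^ d *
      Complex.exp (-((Real.pi * r ^ 2 : ℝ) : ℂ) * ‖ξ‖ ^ 2 +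
        -2 * Real.pi * Complex.I * (inner ℝ z ξ : ℝ)) := by
    intro ξ
    rw [Complex.exp_add, gaussWeight]
    push_cast
    ring_nf
  simp_rw [e]
  rw [integral_const_mul, h]
  have h1 : ((Real.pi : ℂ) / ((Real.pi * r ^ 2 : ℝ) : ℂ)) = (((r⁻¹) ^ 2 : ℝ) : ℂ) := by
    push_cast; field_simp
  have h2 : (((r⁻¹) ^ 2 : ℝ) : ℂ) ^ ((Module.finrank ℝ (EuclideanSpace ℝ (Fin d)) : ℂ) / 2) =
      ((r : ℂ) ^ d)⁻¹ := by
    have : ((Module.finrank ℝ (EuclideanSpace ℝ (Fin d)) : ℂ) / 2) = ((d / 2 : ℝ) : ℂ) := by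
      simp
    rw [this, ← Complex.ofReal_cpow (by positivity), ← Real.rpow_natCast (r⁻¹) 2,
      ← Real.rpow_mul (by positivity)]
    push_cast
    rw [show (2 : ℝ) * (d / 2) = d by ring, Real.rpow_natCast]
    simp
  rw [h1, h2, ← mul_assoc, mul_inv_cancel₀ (pow_ne_zero _ hr'), one_mul, gaussKernel]
  push_cast
  congr 1
  field_simp
  ring_nf
  simp

lemma norm_exp_inner {d : ℕ} (x ξ : EuclideanSpace ℝ (Fin d)) :
    ‖Complex.exp (-2 * Real.pi * Complex.I * (inner ℝ x ξ : ℝ))‖ = 1 := by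
  rw [show -2 * (Real.pi : ℂ) * Complex.I * (inner ℝ x ξ : ℝ) =
    ((-2 * Real.pi * inner ℝ x ξ : ℝ) : ℂ) * Complex.I by push_cast; ring]
  exact Complex.norm_exp_ofReal_mul_I _

lemma norm_measureFourier_le {d : ℕ} (μ : Measure (EuclideanSpace ℝ (Fin d)))
    [IsFiniteMeasure μ] (ξ : EuclideanSpace ℝ (Fin d)) :
    ‖measureFourier μ ξ‖ ≤ μ.real Set.univ := by
  unfold measureFourier
  refine (norm_integral_le_integral_norm _).trans ?_
  simp only [norm_exp_inner]
  simp

lemma measureFourier_eq_charFun {d : ℕ} (μ : Measure (EuclideanSpace ℝ (Fin d)))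
    (ξ : EuclideanSpace ℝ (Fin d)) :
    measureFourier μ ξ = charFun μ ((-2 * Real.pi) • ξ) := by
  unfold measureFourier
  rw [charFun_apply]
  congr with x
  rw [inner_smul_right]
  push_cast
  ring_nf

lemma continuous_measureFourier {d : ℕ} (μ : Measure (EuclideanSpace ℝ (Fin d)))
    [IsFiniteMeasure μ] : Continuous (measureFourier μ) := by
  simp_rw [funext (measureFourier_eq_charFun μ)]
  fun_prop

lemma measureFourier_conv {d : ℕ} (μ ν : Measure (EuclideanSpace ℝ (Fin d)))
    [IsFiniteMeasure μ] [IsFiniteMeasure ν] (ξ : EuclideanSpace ℝ (Fin d)) :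
    measureFourier (μ ∗ ν) ξ = measureFourier μ ξ * measureFourier ν ξ := by
  simp [measureFourier_eq_charFun, charFun_conv]

lemma integral_gaussKernel_eq {d : ℕ} (μ : Measure (EuclideanSpace ℝ (Fin d)))
    [IsFiniteMeasure μ] {r : ℝ} (hr : 0 < r) :
    ∫ p, gaussKernel r (p.1 - p.2) ∂(μ.prod μ) =
      ∫ ξ, gaussWeight r ξ * ‖measureFourier μ ξ‖ ^ 2 := by
  have hint : Integrable (Function.uncurry fun (p : EuclideanSpace ℝ (Fin d) ×
      EuclideanSpace ℝ (Fin d)) (ξ : EuclideanSpace ℝ (Fin d)) => (gaussWeight r ξ : ℂ) *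
      Complex.exp (-2 * Real.pi * Complex.I * (inner ℝ (p.1 - p.2) ξ : ℝ)))
      ((μ.prod μ).prod volume) := by
    have h0 : Integrable (fun q : (EuclideanSpace ℝ (Fin d) × EuclideanSpace ℝ (Fin d)) ×
        EuclideanSpace ℝ (Fin d) => gaussWeight r q.2) ((μ.prod μ).prod volume) :=
      (integrable_gaussWeight hr).comp_snd _
    refine h0.mono ?_ ?_
    · refine Continuous.aestronglyMeasurable ?_
      unfold Function.uncurry gaussWeight
      fun_prop
    · filter_upwards with q
      simp only [Function.uncurry, norm_mul, norm_exp_inner, mul_one, Complex.norm_real, le_refl]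
  have key : ((∫ p, gaussKernel r (p.1 - p.2) ∂(μ.prod μ) : ℝ) : ℂ) =
      ((∫ ξ, gaussWeight r ξ * ‖measureFourier μ ξ‖ ^ 2 : ℝ) : ℂ) := by
    rw [← integral_complex_ofReal, ← integral_complex_ofReal]
    simp_rw [gaussKernel_eq_integral hr]
    rw [integral_integral_swap hint]
    congr with ξ
    rw [integral_const_mul]
    push_cast
    congr 1
    rw [← Complex.mul_conj']
    have h2 : (starRingEnd ℂ) (measureFourier μ ξ) =
        ∫ y, Complex.exp (-(-2 * Real.pi * Complex.I * (inner ℝ y ξ : ℝ))) ∂μ := by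
      unfold measureFourier
      rw [← integral_conj]
      congr with y
      rw [← Complex.exp_conj]
      simp [Complex.conj_ofNat]
    rw [h2, measureFourier, ← integral_prod_mul]
    congr with p
    rw [← Complex.exp_add, inner_sub_left]
    push_cast
    ring_nf
  exact_mod_cast key

theorem gaussEnergy_eq_lintegral_measureFourier {d : ℕ} (μ : Measure (EuclideanSpace ℝ (Fin d)))
    [IsFiniteMeasure μ] {r : ℝ} (hr : 0 < r) :
    gaussEnergy μ r =
      ∫⁻ ξ, ENNReal.ofReal (gaussWeight r ξ) * ENNReal.ofReal (‖measureFourier μ ξ‖ ^ 2) := by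
  have hw : ∀ ξ : EuclideanSpace ℝ (Fin d), 0 ≤ gaussWeight r ξ := fun ξ => by
    unfold gaussWeight; positivity
  have h1 : gaussEnergy μ r =
      ENNReal.ofReal (∫ p, gaussKernel r (p.1 - p.2) ∂(μ.prod μ)) := by
    rw [ofReal_integral_eq_lintegral_ofReal, lintegral_prod, gaussEnergy]
    · exact (ENNReal.continuous_ofReal.comp (by fun_prop)).measurable.aemeasurable
    · refine Integrable.mono' (integrable_const (1 : ℝ))
        (Continuous.aestronglyMeasurable (by fun_prop)) ?_
      filter_upwards with p
      rw [Real.norm_of_nonneg (gaussKernel_nonneg _ _)]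
      exact gaussKernel_le_one _ _
    · filter_upwards with p using gaussKernel_nonneg _ _
  rw [h1, integral_gaussKernel_eq μ hr, ofReal_integral_eq_lintegral_ofReal]
  · simp_rw [ENNReal.ofReal_mul (hw _)]
  · refine ((integrable_gaussWeight hr).mul_const (μ.real Set.univ ^ 2)).mono'
      (((integrable_gaussWeight hr).aestronglyMeasurable).mul
        ((continuous_measureFourier μ).norm.pow 2).aestronglyMeasurable) ?_
    filter_upwards with ξ
    rw [Real.norm_of_nonneg (mul_nonneg (hw ξ) (by positivity))]
    exact mul_le_mul_of_nonneg_left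
      (pow_le_pow_left₀ (norm_nonneg _) (norm_measureFourier_le μ ξ) 2) (hw ξ)
  · filter_upwards with ξ using mul_nonneg (hw ξ) (by positivity)

/-! ### From energy decay to Hausdorff dimension -/

lemma measure_closedBall_le_lintegral_gaussKernel {V : Type*} [NormedAddCommGroup V]
    [MeasurableSpace V] [BorelSpace V] (μ : Measure V) (x : V) {r : ℝ} (hr : 0 < r) :
    μ (Metric.closedBall x r) ≤
      ENNReal.ofReal (Real.exp Real.pi) * ∫⁻ y, ENNReal.ofReal (gaussKernel r (x - y)) ∂μ := by
  rw [← lintegral_const_mul _ (by fun_prop), ← lintegral_indicator_one measurableSet_closedBall]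
  refine lintegral_mono fun y => ?_
  by_cases hy : y ∈ Metric.closedBall x r
  · rw [Set.indicator_of_mem hy, ← ENNReal.ofReal_mul (Real.exp_pos _).le, gaussKernel,
      ← Real.exp_add]
    refine ENNReal.one_le_ofReal.2 (Real.one_le_exp ?_)
    have h1 : ‖x - y‖ ≤ r := by rwa [mem_closedBall_iff_norm'] at hy
    have h2 : ‖x - y‖ ^ 2 / r ^ 2 ≤ 1 := by
      rw [div_le_one (by positivity)]
      exact pow_le_pow_left₀ (norm_nonneg _) h1 2
    have := mul_le_mul_of_nonneg_left h2 Real.pi_pos.le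
    rw [mul_div_assoc]
    linarith
  · rw [Set.indicator_of_notMem hy]
    exact zero_le

/-- Mass distribution principle: after restriction to `G`, only sets meeting `G` carry mass, so the
growth bound is needed only at points of `G`. -/
lemma restrict_le_hausdorffMeasure {X : Type*} [EMetricSpace X] [MeasurableSpace X]
    [BorelSpace X] (μ : Measure X) {G : Set X} (hG : MeasurableSet G) {u : ℝ} {K : ℝ≥0∞}
    (hK : K ≠ 0) (hK' : K ≠ ∞)
    (h : ∀ s : Set X, Metric.ediam s ≤ 1 → ∀ x ∈ s ∩ G, μ s ≤ K * Metric.ediam s ^ u) :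
    K⁻¹ • μ.restrict G ≤ Measure.hausdorffMeasure u := by
  refine Measure.le_hausdorffMeasure _ _ 1 one_pos fun s hs => ?_
  rw [Measure.smul_apply, Measure.restrict_apply' hG, smul_eq_mul]
  rcases (s ∩ G).eq_empty_or_nonempty with h0 | ⟨x, hx⟩
  · simp [h0]
  · calc K⁻¹ * μ (s ∩ G) ≤ K⁻¹ * (K * Metric.ediam s ^ u) :=
        mul_le_mul_right ((measure_mono Set.inter_subset_left).trans (h s hs x hx)) _
      _ = Metric.ediam s ^ u := by
        rw [← mul_assoc, ENNReal.inv_mul_cancel hK hK', one_mul]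

lemma measure_le_ediam_rpow {X : Type*} [PseudoMetricSpace X] [MeasurableSpace X]
    (μ : Measure X) {x : X} {u : ℝ} (hu : 0 < u) {K : ℝ≥0∞} (hK' : K ≠ ∞)
    (h : ∀ n : ℕ, μ (Metric.closedBall x ((1 / 2) ^ n)) ≤ K * ENNReal.ofReal ((1 / 2) ^ n) ^ u)
    {s : Set X} (hs : Metric.ediam s ≤ 1) (hx : x ∈ s) :
    μ s ≤ K * 2 ^ u * Metric.ediam s ^ u := by
  have hfin : Metric.ediam s ≠ ∞ := ne_top_of_le_ne_top ENNReal.one_ne_top hs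
  have hsub : ∀ n : ℕ, Metric.ediam s ≤ ENNReal.ofReal ((1 / 2) ^ n) →
      μ s ≤ K * ENNReal.ofReal ((1 / 2) ^ n) ^ u := fun n hn => by
    refine le_trans (measure_mono fun y hy => ?_) (h n)
    have := (Metric.edist_le_ediam_of_mem hy hx).trans hn
    rwa [edist_le_ofReal (by positivity)] at this
  -- Diameter zero lies below every dyadic scale, so the bound follows in the limit; otherwise
  -- rounding up to a dyadic scale costs the factor `2 ^ u`.
  rcases eq_or_ne (Metric.ediam s) 0 with h0 | h0
  · rw [h0, ENNReal.zero_rpow_of_pos hu, mul_zero]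
    refine ge_of_tendsto' (f := fun n : ℕ => K * ENNReal.ofReal ((1 / 2) ^ n) ^ u)
      (x := Filter.atTop) ?_ fun n => hsub n (by simp [h0])
    have h1 : Filter.Tendsto (fun n : ℕ => ENNReal.ofReal ((1 / 2) ^ n)) Filter.atTop
        (nhds (ENNReal.ofReal 0)) :=
      (ENNReal.continuous_ofReal.tendsto _).comp
        (tendsto_pow_atTop_nhds_zero_of_lt_one (by norm_num) (by norm_num))
    have h2 := ENNReal.Tendsto.const_mul (((ENNReal.continuous_rpow_const (y := u)).tendsto _).comp h1)
      (Or.inr hK')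
    simpa [ENNReal.zero_rpow_of_pos hu] using h2
  · obtain ⟨n, hn1, hn2⟩ := exists_nat_pow_near_of_lt_one (y := (1 / 2 : ℝ))
      (ENNReal.toReal_pos h0 hfin) (ENNReal.toReal_le_of_le_ofReal one_pos.le (by simpa using hs))
      (by norm_num) (by norm_num)
    refine (hsub n ((ENNReal.le_ofReal_iff_toReal_le hfin (by positivity)).2 hn2)).trans ?_
    rw [mul_assoc, ← ENNReal.mul_rpow_of_nonneg _ _ hu.le]
    refine mul_le_mul_right (ENNReal.rpow_le_rpow ?_ hu.le) _
    rw [ENNReal.ofReal_le_iff_le_toReal (ENNReal.mul_ne_top (by simp) hfin), ENNReal.toReal_mul]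
    rw [pow_succ] at hn1
    simp only [ENNReal.toReal_ofNat]
    linarith

/-- Since `v < u`, the weighted sum `H` of the dyadic Gaussian averages `P n` has finite integral.
So `H ≤ M` on a set of positive measure, where the balls of radius `2⁻ⁿ` have mass `≲ 2^{-nv}`. -/
theorem le_dimH_of_gaussEnergy_le {V : Type*} [NormedAddCommGroup V] [MeasurableSpace V]
    [BorelSpace V] [SecondCountableTopology V] (μ : Measure V) [IsFiniteMeasure μ] (hμ : μ ≠ 0)
    {S : Set V} (hS : μ Sᶜ = 0)
    {v : ℝ≥0} {u : ℝ} (hv : 0 < v) (hvu : v < u) {C : ℝ≥0∞} (hC : C ≠ ∞)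
    (h : ∀ r : ℝ, 0 < r → gaussEnergy μ r ≤ C * ENNReal.ofReal (r ^ u)) :
    (v : ℝ≥0∞) ≤ dimH S := by
  set r : ℕ → ℝ := fun n => (1 / 2) ^ n with hr
  have hr0 : ∀ n, 0 < r n := fun n => by positivity
  let P : ℕ → V → ℝ≥0∞ := fun n x => ∫⁻ y, ENNReal.ofReal (gaussKernel (r n) (x - y)) ∂μ
  have hPm : ∀ n, Measurable (P n) := fun n =>
    Measurable.lintegral_prod_right' (f := fun p : V × V =>
      ENNReal.ofReal (gaussKernel (r n) (p.1 - p.2)))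
      (ENNReal.continuous_ofReal.comp (by fun_prop)).measurable
  let H : V → ℝ≥0∞ := fun x => ∑' n, ENNReal.ofReal (r n ^ (-(v : ℝ))) * P n x
  have hHm : Measurable H := Measurable.tsum fun n => (hPm n).const_mul _
  have hHint : ∫⁻ x, H x ∂μ ≠ ∞ := by
    rw [lintegral_tsum fun n => ((hPm n).const_mul _).aemeasurable]
    have hb : ∀ n, ∫⁻ x, ENNReal.ofReal (r n ^ (-(v : ℝ))) * P n x ∂μ ≤
        C * ENNReal.ofReal ((1 / 2) ^ (u - v)) ^ n := fun n => by
      rw [lintegral_const_mul _ (hPm n)]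
      refine (mul_le_mul_right (h (r n) (hr0 n)) _).trans (le_of_eq ?_)
      rw [mul_left_comm, ← ENNReal.ofReal_mul (by positivity), ← Real.rpow_add (hr0 n),
        ← ENNReal.ofReal_pow (by positivity)]
      simp only [hr]
      rw [← Real.rpow_natCast, ← Real.rpow_natCast,
        ← Real.rpow_mul (by positivity), ← Real.rpow_mul (by positivity)]
      ring_nf
    refine ne_top_of_le_ne_top ?_ (ENNReal.tsum_le_tsum hb)
    rw [ENNReal.tsum_mul_left]
    refine ENNReal.mul_ne_top hC ?_
    rw [ENNReal.tsum_geometric, ENNReal.inv_ne_top, ← pos_iff_ne_zero, tsub_pos_iff_lt]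
    exact ENNReal.ofReal_lt_one.2 (Real.rpow_lt_one (by norm_num) (by norm_num) (by linarith))
  obtain ⟨M, hM⟩ : ∃ M : ℕ, μ {x | H x ≤ M} ≠ 0 := by
    by_contra! hcon
    have h1 : μ {x | H x < ∞} = 0 := by
      refine measure_mono_null (fun x hx => ?_) (measure_iUnion_null hcon)
      obtain ⟨n, hn⟩ := ENNReal.exists_nat_gt (ne_of_lt hx)
      exact Set.mem_iUnion.2 ⟨n, hn.le⟩
    have h2 : μ {x | H x < ∞}ᶜ = 0 := ae_lt_top hHm hHint
    refine hμ (Measure.measure_univ_eq_zero.1 ?_)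
    rw [← Set.union_compl_self {x | H x < ∞}]
    exact measure_union_null h1 h2
  have hG : MeasurableSet {x | H x ≤ M} := measurableSet_le hHm measurable_const
  -- The summand `1` keeps `K` nonzero, even if `M = 0`.
  set K : ℝ≥0∞ := ENNReal.ofReal (Real.exp Real.pi) * M * 2 ^ (v : ℝ) + 1 with hKdef
  have h2v : (2 : ℝ≥0∞) ^ (v : ℝ) ≠ ∞ := ENNReal.rpow_ne_top_of_nonneg v.2 (by simp)
  have hK0 : ENNReal.ofReal (Real.exp Real.pi) * M ≠ ∞ :=
    ENNReal.mul_ne_top ENNReal.ofReal_ne_top (by simp)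
  have hK : K ≠ ∞ := ENNReal.add_ne_top.2 ⟨ENNReal.mul_ne_top hK0 h2v, by simp⟩
  have hKz : K ≠ 0 := by simp [hKdef]
  have hle := restrict_le_hausdorffMeasure μ hG (u := v) hKz hK fun s hs x hx => by
    refine (measure_le_ediam_rpow μ (x := x) (u := v) (by exact_mod_cast hv) hK0 (fun n => ?_)
      hs hx.1).trans (mul_le_mul_left le_self_add _)
    refine (measure_closedBall_le_lintegral_gaussKernel μ x (hr0 n)).trans ?_
    rw [mul_assoc]
    refine mul_le_mul_right ?_ _
    have h1 : ENNReal.ofReal (r n ^ (-(v : ℝ))) * P n x ≤ M := (ENNReal.le_tsum n).trans hx.2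
    rw [ENNReal.ofReal_rpow_of_pos (hr0 n)]
    calc P n x = (ENNReal.ofReal (r n ^ (-(v : ℝ))) * P n x) * ENNReal.ofReal (r n ^ (v : ℝ)) := by
          rw [mul_right_comm, ← ENNReal.ofReal_mul (by have := hr0 n; positivity),
            ← Real.rpow_add (hr0 n)]
          simp
      _ ≤ _ := mul_le_mul_left h1 _
  refine le_dimH_of_hausdorffMeasure_ne_zero fun h0 => hM ?_
  have h3 := (hle S).trans_eq h0
  rw [Measure.smul_apply, Measure.restrict_apply' hG, smul_eq_mul, nonpos_iff_eq_zero,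
    mul_eq_zero, ENNReal.inv_eq_zero] at h3
  have h4 := h3.resolve_left hK
  refine measure_mono_null (t := (S ∩ {x | H x ≤ M}) ∪ Sᶜ) (fun x hx => ?_)
    (measure_union_null h4 hS)
  by_cases hxS : x ∈ S
  · exact Or.inl ⟨hxS, hx⟩
  · exact Or.inr hxS

/-! ### Energy of a convolution -/

lemma lintegral_Ioc_rpow {a s : ℝ} (ha : 0 < a) (hs : 0 < s) :
    ∫⁻ ρ in Set.Ioc 0 a, ENNReal.ofReal (ρ ^ (s - 1)) = ENNReal.ofReal (a ^ s / s) := by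
  rw [← ofReal_integral_eq_lintegral_ofReal, ← intervalIntegral.integral_of_le ha.le,
    integral_rpow (Or.inl (by linarith))]
  · simp [Real.zero_rpow hs.ne']
  · exact (intervalIntegral.intervalIntegrable_rpow' (by linarith)).1
  · filter_upwards [ae_restrict_mem measurableSet_Ioc] with ρ hρ using Real.rpow_nonneg hρ.1.le _

lemma lintegral_Ioi_rpow {a p : ℝ} (ha : 0 < a) (hp : 0 < p) :
    ∫⁻ ρ in Set.Ioi a, ENNReal.ofReal (ρ ^ (-p - 1)) = ENNReal.ofReal (a ^ (-p) / p) := by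
  rw [← ofReal_integral_eq_lintegral_ofReal, integral_Ioi_rpow_of_lt (by linarith) ha]
  · congr 1
    rw [show -p - 1 + 1 = -p by ring, neg_div_neg_eq]
  · exact integrableOn_Ioi_rpow_of_lt (by linarith) ha
  · filter_upwards [ae_restrict_mem measurableSet_Ioi] with ρ hρ
    exact Real.rpow_nonneg (ha.trans hρ).le _

/-- On `ρ ≤ 1/a` the Gaussian is at least `exp (-π)`, and that part of the integral is explicit. -/
lemma inv_rpow_le_lintegral_gaussian {a s : ℝ} (ha : 0 < a) (hs : 0 < s) :
    ENNReal.ofReal (a ^ (-s)) ≤ ENNReal.ofReal (s * Real.exp Real.pi) *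
      ∫⁻ ρ in Set.Ioi 0,
        ENNReal.ofReal (ρ ^ (s - 1)) * ENNReal.ofReal (Real.exp (-Real.pi * ρ ^ 2 * a ^ 2)) := by
  have h1 : ∫⁻ ρ in Set.Ioc 0 a⁻¹, ENNReal.ofReal (ρ ^ (s - 1)) *
      ENNReal.ofReal (Real.exp (-Real.pi)) ≤ ∫⁻ ρ in Set.Ioi 0,
        ENNReal.ofReal (ρ ^ (s - 1)) * ENNReal.ofReal (Real.exp (-Real.pi * ρ ^ 2 * a ^ 2)) := by
    refine (setLIntegral_mono' measurableSet_Ioc fun ρ hρ => ?_).trans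
      (lintegral_mono_set Set.Ioc_subset_Ioi_self)
    refine mul_le_mul_right (ENNReal.ofReal_le_ofReal (Real.exp_le_exp.2 ?_)) _
    have h2 : ρ * a ≤ 1 := by
      calc ρ * a ≤ a⁻¹ * a := by gcongr; exact hρ.2
        _ = 1 := inv_mul_cancel₀ ha.ne'
    have h3 : (ρ * a) ^ 2 ≤ 1 := pow_le_one₀ (mul_nonneg hρ.1.le ha.le) h2
    nlinarith [Real.pi_pos]
  refine le_trans (le_of_eq ?_) (mul_le_mul_right h1 _)
  rw [lintegral_mul_const _ (by fun_prop), lintegral_Ioc_rpow (inv_pos.2 ha) hs,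
    ← ENNReal.ofReal_mul (by positivity), ← ENNReal.ofReal_mul (by positivity)]
  congr 1
  rw [Real.inv_rpow ha.le, Real.rpow_neg ha.le, Real.exp_neg]
  field_simp

lemma gaussWeight_mul_exp {d : ℕ} {r ρ : ℝ} (hr : 0 < r) (ξ : EuclideanSpace ℝ (Fin d)) :
    gaussWeight r ξ * Real.exp (-Real.pi * ρ ^ 2 * ‖ξ‖ ^ 2) =
      (r / √(r ^ 2 + ρ ^ 2)) ^ d * gaussWeight (√(r ^ 2 + ρ ^ 2)) ξ := by
  have hR : 0 < √(r ^ 2 + ρ ^ 2) := Real.sqrt_pos.2 (by positivity)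
  unfold gaussWeight
  rw [Real.sq_sqrt (by positivity), mul_assoc, ← Real.exp_add, ← mul_assoc, ← mul_pow,
    div_mul_cancel₀ _ hR.ne']
  ring_nf

/-- With `R = √(r² + ρ²)` the factor is `r^d R^{t-d}`, decreasing in `R`. Use `R ≥ r` for `ρ ≤ r`
and `R ≥ ρ` beyond; the tail converges because `s + t < d`. -/
lemma lintegral_rpow_mul_sqrt_le {d : ℕ} {r s t : ℝ} (hr : 0 < r) (hs : 0 < s) (hst : s + t < d) :
    ∫⁻ ρ in Set.Ioi 0, ENNReal.ofReal (ρ ^ (s - 1)) *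
      ENNReal.ofReal ((r / √(r ^ 2 + ρ ^ 2)) ^ d * √(r ^ 2 + ρ ^ 2) ^ t) ≤
      ENNReal.ofReal (1 / s + 1 / (d - s - t)) * ENNReal.ofReal (r ^ (s + t)) := by
  have hb : ∀ {ρ R' : ℝ}, 0 < R' → R' ≤ √(r ^ 2 + ρ ^ 2) →
      (r / √(r ^ 2 + ρ ^ 2)) ^ d * √(r ^ 2 + ρ ^ 2) ^ t ≤ r ^ (d : ℝ) * R' ^ (t - d) := by
    intro ρ R' h0 hle
    have hR := h0.trans_le hle
    rw [div_pow, div_mul_eq_mul_div, mul_div_assoc, ← Real.rpow_natCast r,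
      ← Real.rpow_natCast (√_), ← Real.rpow_sub hR]
    exact mul_le_mul_of_nonneg_left
      (Real.rpow_le_rpow_of_nonpos h0 hle (by linarith)) (by positivity)
  have h1 : ∫⁻ ρ in Set.Ioc 0 r, ENNReal.ofReal (ρ ^ (s - 1)) *
      ENNReal.ofReal ((r / √(r ^ 2 + ρ ^ 2)) ^ d * √(r ^ 2 + ρ ^ 2) ^ t) ≤
      ENNReal.ofReal (1 / s * r ^ (s + t)) := by
    refine (lintegral_mono fun ρ => mul_le_mul_right (ENNReal.ofReal_le_ofReal
      (hb hr (Real.le_sqrt_of_sq_le (by nlinarith)))) _).trans (le_of_eq ?_)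
    rw [lintegral_mul_const _ (by fun_prop), lintegral_Ioc_rpow hr hs,
      ← ENNReal.ofReal_mul (by positivity), ← Real.rpow_add hr, add_sub_cancel, Real.rpow_add hr]
    ring_nf
  have h2 : ∫⁻ ρ in Set.Ioi r, ENNReal.ofReal (ρ ^ (s - 1)) *
      ENNReal.ofReal ((r / √(r ^ 2 + ρ ^ 2)) ^ d * √(r ^ 2 + ρ ^ 2) ^ t) ≤
      ENNReal.ofReal (1 / (d - s - t) * r ^ (s + t)) := by
    have h3 : ∀ ρ ∈ Set.Ioi r, ENNReal.ofReal (ρ ^ (s - 1)) *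
      ENNReal.ofReal ((r / √(r ^ 2 + ρ ^ 2)) ^ d * √(r ^ 2 + ρ ^ 2) ^ t) ≤
      ENNReal.ofReal (ρ ^ (-(d - s - t) - 1)) * ENNReal.ofReal (r ^ (d : ℝ)) := fun ρ hρ => by
      have hρ0 : 0 < ρ := hr.trans hρ
      rw [← ENNReal.ofReal_mul (by positivity), ← ENNReal.ofReal_mul (by positivity)]
      refine ENNReal.ofReal_le_ofReal ?_
      refine (mul_le_mul_of_nonneg_left (hb (ρ := ρ) hρ0
        (Real.le_sqrt_of_sq_le (by nlinarith))) (by positivity)).trans (le_of_eq ?_)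
      rw [mul_left_comm, ← Real.rpow_add hρ0, mul_comm]
      ring_nf
    refine (setLIntegral_mono' measurableSet_Ioi h3).trans (le_of_eq ?_)
    rw [lintegral_mul_const _ (by fun_prop), lintegral_Ioi_rpow hr (by linarith),
      ← ENNReal.ofReal_mul (by have : 0 < d - s - t := by linarith
                               positivity), div_mul_eq_mul_div, ← Real.rpow_add hr]
    ring_nf
  have hd : 0 < d - s - t := by linarith
  rw [← Set.Ioc_union_Ioi_eq_Ioi hr.le, ← ENNReal.ofReal_mul (by positivity), add_mul,
    ENNReal.ofReal_add (by positivity) (by positivity)]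
  exact (lintegral_union_le _ _ _).trans (add_le_add h1 h2)

lemma ofReal_sq_le_of_decay {d : ℕ} {f : EuclideanSpace ℝ (Fin d) → ℂ} {s C : ℝ} (hs : 0 < s)
    (hf : ∀ ξ, ‖f ξ‖ ^ 2 * ‖ξ‖ ^ s ≤ C) {ξ : EuclideanSpace ℝ (Fin d)} (hξ : ξ ≠ 0) :
    ENNReal.ofReal (‖f ξ‖ ^ 2) ≤ ENNReal.ofReal (C * (s * Real.exp Real.pi)) *
      ∫⁻ ρ in Set.Ioi 0,
        ENNReal.ofReal (ρ ^ (s - 1)) * ENNReal.ofReal (Real.exp (-Real.pi * ρ ^ 2 * ‖ξ‖ ^ 2)) := by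
  have hn : 0 < ‖ξ‖ := norm_pos_iff.2 hξ
  have hC : 0 ≤ C := le_trans (by positivity) (hf ξ)
  rw [ENNReal.ofReal_mul hC, mul_assoc]
  refine le_trans ?_ (mul_le_mul_right (inv_rpow_le_lintegral_gaussian hn hs) _)
  rw [← ENNReal.ofReal_mul hC]
  refine ENNReal.ofReal_le_ofReal ?_
  rw [Real.rpow_neg hn.le, ← div_eq_mul_inv, le_div_iff₀ (by positivity)]
  exact hf ξ

theorem gaussEnergy_conv_le {d : ℕ} (μ ν : Measure (EuclideanSpace ℝ (Fin d)))
    [IsFiniteMeasure μ] [IsFiniteMeasure ν] {s t C : ℝ} (hs : 0 < s) (ht : 0 ≤ t) (hst : s + t < d)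
    (hμ : ∀ ξ, ‖measureFourier μ ξ‖ ^ 2 * ‖ξ‖ ^ s ≤ C) {D : ℝ≥0∞} (hD : D ≠ ∞)
    (hν : ∀ r : ℝ, 0 < r → gaussEnergy ν r ≤ D * ENNReal.ofReal (r ^ t)) :
    ∃ C' : ℝ≥0∞, C' ≠ ∞ ∧ ∀ r : ℝ, 0 < r →
      gaussEnergy (μ ∗ ν) r ≤ C' * ENNReal.ofReal (r ^ (s + t)) := by
  have hd : (0 : ℝ) < d := by linarith
  -- In positive dimension a point is Lebesgue null, so `ξ = 0`, where the decay bound is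
  -- unavailable, can be discarded.
  have : NeZero d := ⟨by rintro rfl; simp at hd⟩
  set K := ENNReal.ofReal (C * (s * Real.exp Real.pi)) with hK
  refine ⟨K * (D * ENNReal.ofReal (1 / s + 1 / (d - s - t))), ENNReal.mul_ne_top
    ENNReal.ofReal_ne_top (ENNReal.mul_ne_top hD ENNReal.ofReal_ne_top), fun r hr => ?_⟩
  have hw : ∀ (R : ℝ) (ξ : EuclideanSpace ℝ (Fin d)), 0 < R → 0 ≤ gaussWeight R ξ :=
    fun R ξ hR => by unfold gaussWeight; positivity
  have hνm : Measurable (measureFourier ν) := (continuous_measureFourier ν).measurable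
  have hwm : ∀ R, Measurable (gaussWeight R : EuclideanSpace ℝ (Fin d) → ℝ) := fun R => by
    unfold gaussWeight; fun_prop
  have hwr := hwm r
  let F : EuclideanSpace ℝ (Fin d) → ℝ → ℝ≥0∞ := fun ξ ρ =>
    ENNReal.ofReal (gaussWeight r ξ) * ENNReal.ofReal (‖measureFourier ν ξ‖ ^ 2) *
      (ENNReal.ofReal (ρ ^ (s - 1)) * ENNReal.ofReal (Real.exp (-Real.pi * ρ ^ 2 * ‖ξ‖ ^ 2)))
  have hFm : Measurable (Function.uncurry F) := by
    unfold Function.uncurry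
    fun_prop
  calc gaussEnergy (μ ∗ ν) r
      = ∫⁻ ξ, ENNReal.ofReal (gaussWeight r ξ) *
          ENNReal.ofReal (‖measureFourier (μ ∗ ν) ξ‖ ^ 2) :=
        gaussEnergy_eq_lintegral_measureFourier _ hr
    _ ≤ ∫⁻ ξ, K * ∫⁻ ρ in Set.Ioi 0, F ξ ρ := by
        refine lintegral_mono_ae ?_
        filter_upwards [compl_mem_ae_iff.2 (measure_singleton (0 : EuclideanSpace ℝ (Fin d)))]
          with ξ hξ
        simp only [F]
        rw [lintegral_const_mul _ (by fun_prop), measureFourier_conv, norm_mul, mul_pow,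
          ENNReal.ofReal_mul (by positivity), mul_left_comm K, mul_assoc,
          mul_comm (ENNReal.ofReal (‖measureFourier μ ξ‖ ^ 2))]
        gcongr
        exact ofReal_sq_le_of_decay hs hμ hξ
    _ = K * ∫⁻ ρ in Set.Ioi 0, ∫⁻ ξ, F ξ ρ := by
        have hm : Measurable fun ξ => ∫⁻ ρ in Set.Ioi 0, F ξ ρ := hFm.lintegral_prod_right'
        rw [lintegral_const_mul _ hm, lintegral_lintegral_swap hFm.aemeasurable]
    _ = K * ∫⁻ ρ in Set.Ioi 0, ENNReal.ofReal (ρ ^ (s - 1)) *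
          (ENNReal.ofReal ((r / √(r ^ 2 + ρ ^ 2)) ^ d) * gaussEnergy ν (√(r ^ 2 + ρ ^ 2))) := by
        congr 1
        refine lintegral_congr fun ρ => ?_
        have hR : 0 < √(r ^ 2 + ρ ^ 2) := Real.sqrt_pos.2 (by positivity)
        have hwR := hwm (√(r ^ 2 + ρ ^ 2))
        rw [gaussEnergy_eq_lintegral_measureFourier _ hR, ← lintegral_const_mul _ (by fun_prop),
          ← lintegral_const_mul _ (by fun_prop)]
        refine lintegral_congr fun ξ => ?_
        rw [← mul_assoc (ENNReal.ofReal (_ ^ d)), ← ENNReal.ofReal_mul (by positivity),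
          ← gaussWeight_mul_exp hr, ENNReal.ofReal_mul (hw r ξ hr)]
        simp only [F]
        ring
    _ ≤ K * ∫⁻ ρ in Set.Ioi 0, D * (ENNReal.ofReal (ρ ^ (s - 1)) *
          ENNReal.ofReal ((r / √(r ^ 2 + ρ ^ 2)) ^ d * √(r ^ 2 + ρ ^ 2) ^ t)) := by
        refine mul_le_mul_right (lintegral_mono fun ρ => ?_) _
        have hR : 0 < √(r ^ 2 + ρ ^ 2) := Real.sqrt_pos.2 (by positivity)
        refine (mul_le_mul_right (mul_le_mul_right (hν _ hR) _) _).trans (le_of_eq ?_)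
        rw [ENNReal.ofReal_mul (by positivity)]
        ring
    _ ≤ _ := by
        rw [lintegral_const_mul _ (by fun_prop), mul_assoc, mul_assoc]
        gcongr
        exact lintegral_rpow_mul_sqrt_le hr hs hst

/-! ### Riesz potentials of small measures -/

lemma enorm_rpow_neg_le_tsum {V : Type*} [NormedAddCommGroup V] {t : ℝ} (ht : 0 < t) (x y : V) :
    ‖x - y‖ₑ ^ (-t) ≤ 1 + ∑' n : ℕ, ENNReal.ofReal (((1 / 2) ^ (n + 1)) ^ (-t)) *
      (Metric.closedBall x ((1 / 2) ^ n)).indicator 1 y := by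
  rcases eq_or_ne x y with rfl | hxy
  · have h1 : (∑' n : ℕ, ENNReal.ofReal (((1 / 2) ^ (n + 1)) ^ (-t)) *
        (Metric.closedBall x ((1 / 2) ^ n)).indicator 1 x) = ∞ := by
      refine top_unique ((ENNReal.tsum_const_eq_top_of_ne_zero (α := ℕ) one_ne_zero).symm.le.trans
        (ENNReal.tsum_le_tsum fun n => ?_))
      rw [Set.indicator_of_mem (Metric.mem_closedBall_self (by positivity)), Pi.one_apply, mul_one,
        ENNReal.one_le_ofReal]
      exact Real.one_le_rpow_of_pos_of_le_one_of_nonpos (by positivity)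
        (pow_le_one₀ (by norm_num) (by norm_num)) (by linarith)
    rw [h1, add_top]
    exact le_top
  · have hz : 0 < ‖x - y‖ := norm_pos_iff.2 (sub_ne_zero.2 hxy)
    rw [← ofReal_norm, ENNReal.ofReal_rpow_of_pos hz]
    rcases le_total 1 ‖x - y‖ with h1 | h1
    · refine le_trans ?_ le_self_add
      rw [ENNReal.ofReal_le_one]
      exact Real.rpow_le_one_of_one_le_of_nonpos h1 (by linarith)
    · obtain ⟨n, hn1, hn2⟩ := exists_nat_pow_near_of_lt_one (y := (1 / 2 : ℝ)) hz h1
        (by norm_num) (by norm_num)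
      refine le_trans ?_ le_add_self
      refine le_trans ?_ (ENNReal.le_tsum n)
      rw [Set.indicator_of_mem (by rwa [mem_closedBall_iff_norm']), Pi.one_apply, mul_one]
      exact ENNReal.ofReal_le_ofReal
        (Real.rpow_le_rpow_of_nonpos (by positivity) hn1.le (by linarith))

lemma exists_lintegral_enorm_rpow_neg_le {t t' : ℝ} (ht : 0 < t) (htt : t < t') :
    ∃ A : ℝ≥0∞, A ≠ ∞ ∧ ∀ {V : Type*} [NormedAddCommGroup V] [MeasurableSpace V] [BorelSpace V]
      (σ : Measure V) (x : V) (c : ℝ≥0∞),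
      (∀ n : ℕ, σ (Metric.closedBall x ((1 / 2) ^ n)) ≤
        c * ENNReal.ofReal (((1 / 2) ^ n) ^ t')) →
      ∫⁻ y, ‖x - y‖ₑ ^ (-t) ∂σ ≤ σ Set.univ + A * c := by
  refine ⟨∑' n : ℕ, ENNReal.ofReal (((1 / 2) ^ (n + 1)) ^ (-t) * ((1 / 2) ^ n) ^ t'), ?_,
    fun {V} _ _ _ σ x c h => ?_⟩
  · have h1 : ∀ n : ℕ, ENNReal.ofReal (((1 / 2) ^ (n + 1)) ^ (-t) * ((1 / 2) ^ n) ^ t') =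
        ENNReal.ofReal ((1 / 2) ^ (-t)) * ENNReal.ofReal ((1 / 2) ^ (t' - t)) ^ n := fun n => by
      rw [← ENNReal.ofReal_pow (by positivity), ← ENNReal.ofReal_mul (by positivity)]
      congr 1
      rw [← Real.rpow_natCast, ← Real.rpow_natCast, ← Real.rpow_natCast,
        ← Real.rpow_mul (by norm_num), ← Real.rpow_mul (by norm_num),
        ← Real.rpow_mul (by norm_num), ← Real.rpow_add (by norm_num),
        ← Real.rpow_add (by norm_num)]
      push_cast
      ring_nf
    simp_rw [h1]
    rw [ENNReal.tsum_mul_left]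
    refine ENNReal.mul_ne_top ENNReal.ofReal_ne_top ?_
    rw [ENNReal.tsum_geometric, ENNReal.inv_ne_top, ← pos_iff_ne_zero, tsub_pos_iff_lt]
    exact ENNReal.ofReal_lt_one.2 (Real.rpow_lt_one (by norm_num) (by norm_num) (by linarith))
  · have hm : ∀ n : ℕ, Measurable ((Metric.closedBall x ((1 / 2) ^ n)).indicator
        (1 : V → ℝ≥0∞)) := fun n => measurable_one.indicator measurableSet_closedBall
    refine (lintegral_mono (enorm_rpow_neg_le_tsum ht x)).trans ?_
    rw [lintegral_add_left measurable_const, lintegral_const, one_mul,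
      lintegral_tsum fun n => ((hm n).const_mul _).aemeasurable, ← ENNReal.tsum_mul_right]
    refine add_le_add_right (ENNReal.tsum_le_tsum fun n => ?_) _
    rw [lintegral_const_mul _ (hm n), lintegral_indicator_one measurableSet_closedBall,
      ENNReal.ofReal_mul (by positivity), mul_assoc, mul_comm _ c]
    exact mul_le_mul_right (h n) _

/-- If every dyadic ball about `x` had mass below `c` times its radius to the power `t'`, the
potential at `x` would be at most `1/4 + A * c ≤ 1/2`. So each point of `K` has a heavy ball; Vitali
makes a selection disjoint, and disjointness bounds the sum by the total mass. -/
lemma exists_cover_of_one_le_potential {t t' : ℝ} (ht : 0 < t) (htt : t < t') :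
    ∃ B : ℝ≥0∞, B ≠ ∞ ∧ ∀ {V : Type*} [NormedAddCommGroup V] [NormedSpace ℝ V]
      [SecondCountableTopology V] [MeasurableSpace V] [BorelSpace V]
      (σ : Measure V) (K : Set V), σ Set.univ ≤ 1 / 4 →
      (∀ x ∈ K, 1 ≤ ∫⁻ y, ‖x - y‖ₑ ^ (-t) ∂σ) →
      ∃ (u : Set V) (ρ : V → ℝ), u.Countable ∧ K ⊆ ⋃ x : u, Metric.closedBall (x : V) (ρ x) ∧
        ∑' x : u, Metric.ediam (Metric.closedBall (x : V) (ρ x)) ^ t' ≤ B * σ Set.univ := by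
  obtain ⟨A, hA, hpot⟩ := exists_lintegral_enorm_rpow_neg_le ht htt
  have ht' : 0 < t' := ht.trans htt
  set c : ℝ≥0∞ := (4 * (A + 1))⁻¹ with hc
  have hA1 : 4 * (A + 1) ≠ ∞ := ENNReal.mul_ne_top (by simp) (by simp [hA])
  have hc0 : c ≠ 0 := by rw [hc]; exact ENNReal.inv_ne_zero.2 hA1
  have hc1 : c ≠ ∞ := by rw [hc]; simp
  have hAc : A * c ≤ 1 / 4 := by
    calc A * c ≤ (A + 1) * c := mul_le_mul_left le_self_add _
      _ = 1 / 4 := by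
        rw [hc, ENNReal.mul_inv (by simp) (by simp), mul_left_comm, ENNReal.mul_inv_cancel
          (by simp) (by simp [hA])]
        simp
  -- The `10` is twice the Vitali enlargement factor `5`, passing from radius to diameter.
  refine ⟨10 ^ t' * c⁻¹, ENNReal.mul_ne_top (ENNReal.rpow_ne_top_of_nonneg ht'.le (by simp))
    (by simpa using hc0), fun {V} _ _ _ _ _ σ K hσ hK => ?_⟩
  have hex : ∀ x ∈ K, ∃ n : ℕ, c * ENNReal.ofReal (((1 / 2) ^ n) ^ t') ≤
      σ (Metric.closedBall x ((1 / 2) ^ n)) := fun x hx => by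
    by_contra! hcon
    have h1 := (hK x hx).trans (hpot σ x c fun n => (hcon n).le)
    have h2 := h1.trans (add_le_add hσ hAc)
    have h3 : (1 / 4 + 1 / 4 : ℝ≥0∞) < 1 := by
      rw [← ENNReal.toReal_lt_toReal (by simp) (by simp), ENNReal.toReal_add (by simp) (by simp)]
      norm_num
    exact absurd h2 (not_le.2 h3)
  choose! n hn using hex
  obtain ⟨u, huK, hud, hcov⟩ := Vitali.exists_disjoint_subfamily_covering_enlargement_closedBall
    K id (fun x => (1 / 2 : ℝ) ^ n x) 1 (fun x _ => pow_le_one₀ (by norm_num) (by norm_num)) 5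
    (by norm_num)
  have huc : u.Countable := hud.countable_of_nonempty_interior fun x _ =>
    ⟨x, Metric.ball_subset_interior_closedBall (Metric.mem_ball_self (by positivity))⟩
  have := huc.to_subtype
  refine ⟨u, fun x => 5 * (1 / 2 : ℝ) ^ n x, huc, fun x hx => ?_, ?_⟩
  · obtain ⟨b, hb, hxb⟩ := hcov x hx
    exact Set.mem_iUnion.2 ⟨⟨b, hb⟩, hxb (Metric.mem_closedBall_self (by positivity))⟩
  · have h1 : ∀ x : u, Metric.ediam (Metric.closedBall (x : V) (5 * (1 / 2 : ℝ) ^ n x)) ^ t' ≤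
        10 ^ t' * c⁻¹ * σ (Metric.closedBall (x : V) ((1 / 2) ^ n (x : V))) := fun x => by
      have h2 : Metric.ediam (Metric.closedBall (x : V) (5 * (1 / 2 : ℝ) ^ n x)) ≤
          10 * ENNReal.ofReal ((1 / 2) ^ n (x : V)) := by
        rw [← Metric.closedEBall_ofReal (by positivity)]
        refine Metric.ediam_closedEBall_le.trans (le_of_eq ?_)
        rw [ENNReal.ofReal_mul (by norm_num), ← mul_assoc]
        norm_num
      refine (ENNReal.rpow_le_rpow h2 ht'.le).trans ?_
      rw [ENNReal.mul_rpow_of_nonneg _ _ ht'.le, mul_assoc]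
      refine mul_le_mul_right ?_ _
      rw [ENNReal.ofReal_rpow_of_pos (by positivity)]
      calc _ = c⁻¹ * (c * ENNReal.ofReal (((1 / 2) ^ n (x : V)) ^ t')) := by
            rw [← mul_assoc, ENNReal.inv_mul_cancel hc0 hc1, one_mul]
        _ ≤ _ := mul_le_mul_right (hn x (huK x.2)) _
    refine (ENNReal.tsum_le_tsum h1).trans ?_
    rw [ENNReal.tsum_mul_left]
    refine mul_le_mul_right (tsum_measure_le_measure_univ
      (fun x => measurableSet_closedBall.nullMeasurableSet) fun x y hxy => ?_) _
    exact (hud x.2 y.2 (by simpa [Subtype.ext_iff] using hxy)).aedisjoint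

theorem hausdorffMeasure_eq_zero_of_potential {V : Type*} [NormedAddCommGroup V] [NormedSpace ℝ V]
    [SecondCountableTopology V] [MeasurableSpace V] [BorelSpace V]
    {t t' : ℝ} (ht : 0 < t) (htt : t < t') (K : Set V)
    (h : ∀ ε : ℝ≥0∞, ε ≠ 0 → ∃ σ : Measure V, σ Set.univ ≤ ε ∧
      ∀ x ∈ K, 1 ≤ ∫⁻ y, ‖x - y‖ₑ ^ (-t) ∂σ) :
    Measure.hausdorffMeasure t' K = 0 := by
  have ht' : 0 < t' := ht.trans htt
  obtain ⟨B, hB, hcov⟩ := exists_cover_of_one_le_potential ht htt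
  let ε : ℕ → ℝ≥0∞ := fun n => ((n : ℝ≥0∞) + 4)⁻¹
  have hε0 : ∀ n, ε n ≠ 0 := fun n => by simp [ε]
  have hε4 : ∀ n, ε n ≤ 1 / 4 := fun n => by
    simp only [ε, one_div]
    exact ENNReal.inv_le_inv.2 le_add_self
  have hεt : Filter.Tendsto ε Filter.atTop (nhds 0) := by
    refine tendsto_of_tendsto_of_tendsto_of_le_of_le tendsto_const_nhds
      ENNReal.tendsto_inv_nat_nhds_zero (fun _ => zero_le) fun n => ?_
    exact ENNReal.inv_le_inv.2 le_self_add
  choose σ hσ hσK using fun n => h (ε n) (hε0 n)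
  choose u ρ huc huK hsum using fun n => hcov (σ n) K ((hσ n).trans (hε4 n)) (hσK n)
  have hsum' : ∀ n, ∑' x : u n, Metric.ediam (Metric.closedBall (x : V) (ρ n x)) ^ t' ≤
      B * ε n := fun n => (hsum n).trans (mul_le_mul_right (hσ n) _)
  have hBε : Filter.Tendsto (fun n => B * ε n) Filter.atTop (nhds 0) := by
    simpa using ENNReal.Tendsto.const_mul hεt (Or.inr hB)
  have hcount : ∀ n, Countable (u n) := fun n => (huc n).to_subtype
  -- Each term of a cover's sum is at most `B * ε n`, so the diameters tend to zero together with
  -- the sums.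
  have hle := Measure.hausdorffMeasure_le_liminf_tsum t' K (l := Filter.atTop)
    (fun n => (B * ε n) ^ t'⁻¹) ?_ (fun n (x : u n) => Metric.closedBall (x : V) (ρ n x))
    (Filter.Eventually.of_forall fun n x => ?_) (Filter.Eventually.of_forall huK)
  · refine nonpos_iff_eq_zero.1 (hle.trans ?_)
    rw [← hBε.liminf_eq]
    exact Filter.liminf_le_liminf (Filter.Eventually.of_forall hsum')
  · have := ((ENNReal.continuous_rpow_const (y := t'⁻¹)).tendsto 0).comp hBε
    rwa [ENNReal.zero_rpow_of_pos (by positivity)] at this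
  · rw [ENNReal.le_rpow_inv_iff ht']
    exact (ENNReal.le_tsum x).trans (hsum' n)

/-! ### Duality between dominating masses and measures -/

/-- The total masses of the finite measures whose `k`-potential dominates `f`. -/
def dominatingMasses {X Y : Type*} [MeasurableSpace Y] (k : X → Y → ℝ≥0∞) (f : X → ℝ) : Set ℝ :=
  {m | ∃ σ : Measure Y, IsFiniteMeasure σ ∧ σ.real Set.univ = m ∧
    ∀ x, ENNReal.ofReal (f x) ≤ ∫⁻ y, k x y ∂σ}

section dominatingMasses

variable {X Y : Type*} [MeasurableSpace Y] {k : X → Y → ℝ≥0∞}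

lemma nonneg_of_mem_dominatingMasses {f : X → ℝ} {m : ℝ} (hm : m ∈ dominatingMasses k f) :
    0 ≤ m := by
  obtain ⟨σ, _, rfl, _⟩ := hm
  exact measureReal_nonneg

lemma bddBelow_dominatingMasses (f : X → ℝ) : BddBelow (dominatingMasses k f) :=
  ⟨0, fun _ => nonneg_of_mem_dominatingMasses⟩

lemma smul_mem_dominatingMasses {f g : X → ℝ} {m c : ℝ} (hc : 0 ≤ c)
    (hfg : ∀ x, g x ≤ c * f x) (hm : m ∈ dominatingMasses k f) :
    c * m ∈ dominatingMasses k g := by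
  obtain ⟨σ, hσ, rfl, h⟩ := hm
  refine ⟨ENNReal.ofReal c • σ, Measure.smul_finite _ ENNReal.ofReal_ne_top, ?_, fun x => ?_⟩
  · rw [measureReal_ennreal_smul_apply, ENNReal.toReal_ofReal hc]
  · rw [lintegral_smul_measure, smul_eq_mul]
    refine (ENNReal.ofReal_le_ofReal (hfg x)).trans ?_
    rw [ENNReal.ofReal_mul hc]
    exact mul_le_mul_right (h x) _

lemma add_mem_dominatingMasses {f g : X → ℝ} {m n : ℝ} (hm : m ∈ dominatingMasses k f)
    (hn : n ∈ dominatingMasses k g) : m + n ∈ dominatingMasses k (f + g) := by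
  obtain ⟨σ, hσ, rfl, h⟩ := hm
  obtain ⟨τ, hτ, rfl, h'⟩ := hn
  refine ⟨σ + τ, inferInstance, measureReal_add_apply, fun x => ?_⟩
  rw [lintegral_add_measure]
  exact ENNReal.ofReal_add_le.trans (add_le_add (h x) (h' x))

lemma zero_mem_dominatingMasses {f : X → ℝ} (hf : ∀ x, f x ≤ 0) :
    (0 : ℝ) ∈ dominatingMasses k f :=
  ⟨0, inferInstance, by simp, fun x => by simp [ENNReal.ofReal_of_nonpos (hf x)]⟩

lemma sInf_dominatingMasses_nonneg (f : X → ℝ) : 0 ≤ sInf (dominatingMasses k f) :=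
  Real.sInf_nonneg fun _ => nonneg_of_mem_dominatingMasses

lemma sInf_dominatingMasses_mul {f g : X → ℝ} {c : ℝ} (hc : 0 < c) (hg : ∀ x, g x = c * f x)
    (hne : (dominatingMasses k f).Nonempty) (hne' : (dominatingMasses k g).Nonempty) :
    sInf (dominatingMasses k g) = c * sInf (dominatingMasses k f) := by
  refine le_antisymm ?_ ?_
  · rw [← div_le_iff₀' hc]
    refine le_csInf hne fun m hm => ?_
    rw [div_le_iff₀' hc]
    exact csInf_le (bddBelow_dominatingMasses g)
      (smul_mem_dominatingMasses hc.le (fun x => (hg x).le) hm)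
  · refine le_csInf hne' fun m hm => ?_
    rw [← le_div_iff₀' hc, div_eq_inv_mul]
    refine csInf_le (bddBelow_dominatingMasses f)
      (smul_mem_dominatingMasses (inv_nonneg.2 hc.le) (fun x => ?_) hm)
    rw [hg x, inv_mul_cancel_left₀ hc.ne']

lemma sInf_dominatingMasses_add_le {f g : X → ℝ} (hne : (dominatingMasses k f).Nonempty)
    (hne' : (dominatingMasses k g).Nonempty) :
    sInf (dominatingMasses k (f + g)) ≤
      sInf (dominatingMasses k f) + sInf (dominatingMasses k g) := by
  rw [← sub_le_iff_le_add]
  refine le_csInf hne fun m hm => ?_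
  rw [sub_le_comm]
  refine le_csInf hne' fun n hn => ?_
  rw [sub_le_iff_le_add']
  exact csInf_le (bddBelow_dominatingMasses _) (add_mem_dominatingMasses hm hn)

end dominatingMasses

/-- If every finite measure whose `k`-potential is at least `1` has mass at least `ε`, then there
is a non-zero finite measure `ν` such that `∫ f ∂ν` is at most the mass of any finite measure
whose `k`-potential dominates `f`. -/
theorem exists_measure_integral_le_of_potential {X Y : Type*} [TopologicalSpace X]
    [CompactSpace X] [T2Space X] [MeasurableSpace X] [BorelSpace X] [MeasurableSpace Y]
    (k : X → Y → ℝ≥0∞) (hne : (dominatingMasses k (fun _ => 1)).Nonempty) {ε : ℝ} (hε : 0 < ε)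
    (hlow : ∀ m ∈ dominatingMasses k (fun _ => 1), ε ≤ m) :
    ∃ ν : Measure X, IsFiniteMeasure ν ∧ ν ≠ 0 ∧
      ∀ f : C(X, ℝ), ∀ m ∈ dominatingMasses k f, ∫ x, f x ∂ν ≤ m := by
  have hne' : ∀ f : C(X, ℝ), (dominatingMasses k f).Nonempty := fun f => by
    obtain ⟨m, hm⟩ := hne
    refine ⟨_, smul_mem_dominatingMasses (norm_nonneg f) (fun x => ?_) hm⟩
    rw [mul_one]
    exact (le_abs_self _).trans (f.norm_coe_le_norm x)
  -- This functional is sublinear; Hahn-Banach extends `c • 1 ↦ c * p 1` to a linear `L ≤ p`.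
  let p : C(X, ℝ) → ℝ := fun f => sInf (dominatingMasses k f)
  have hp1 : ε ≤ p 1 := le_csInf (hne' 1) hlow
  have hXne : (1 : C(X, ℝ)) ≠ 0 := by
    intro h
    have h0 : (0 : ℝ) ∈ dominatingMasses k (fun _ : X => (1 : ℝ)) := by
      refine zero_mem_dominatingMasses fun x => ?_
      have := DFunLike.congr_fun h x
      simp at this
    exact absurd (hlow 0 h0) (not_le.2 hε)
  obtain ⟨L, hL1, hL2⟩ := exists_extension_of_le_sublinear
    (LinearPMap.mkSpanSingleton (1 : C(X, ℝ)) (p 1) hXne) p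
    (fun c hc f => sInf_dominatingMasses_mul hc (fun x => rfl) (hne' _) (hne' _))
    (fun f g => sInf_dominatingMasses_add_le (hne' _) (hne' _))
    (by
      rintro ⟨f, hf⟩
      obtain ⟨c, rfl⟩ := Submodule.mem_span_singleton.1 hf
      refine (LinearPMap.mkSpanSingleton'_apply _ _ _ c hf).trans_le ?_
      rcases le_or_gt c 0 with hc | hc
      · exact (mul_nonpos_of_nonpos_of_nonneg hc (hε.le.trans hp1)).trans
          (sInf_dominatingMasses_nonneg _)
      · exact (sInf_dominatingMasses_mul (f := (1 : C(X, ℝ))) (g := (c • 1 : C(X, ℝ))) hc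
          (fun x => rfl) (hne' _) (hne' _)).ge)
  have hL1' : L 1 = p 1 := by
    have := hL1 ⟨1, Submodule.mem_span_singleton_self _⟩
    rw [this]
    exact LinearPMap.mkSpanSingleton'_apply_self _ _ _ _
  -- Positivity is automatic: the zero measure dominates `-f`, so `L (-f) ≤ p (-f) ≤ 0`. Riesz
  -- representation then applies.
  have hLpos : ∀ f : C(X, ℝ), (∀ x, 0 ≤ f x) → 0 ≤ L f := fun f hf => by
    have h1 := hL2 (-f)
    have h2 : p (-f) ≤ 0 := csInf_le (bddBelow_dominatingMasses _)
      (zero_mem_dominatingMasses fun x => by simpa using hf x)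
    rw [map_neg] at h1
    linarith
  let Λ : CompactlySupportedContinuousMap X ℝ →ₚ[ℝ] ℝ := PositiveLinearMap.mk₀
    { toFun := fun f => L (f : C(X, ℝ))
      map_add' := fun f g => L.map_add (f : C(X, ℝ)) (g : C(X, ℝ))
      map_smul' := fun c f => L.map_smul c (f : C(X, ℝ)) }
    (fun f hf => hLpos _ hf)
  have hint : ∀ f : C(X, ℝ), ∫ x, f x ∂(RealRMK.rieszMeasure Λ) = L f := fun f =>
    RealRMK.integral_rieszMeasure Λ (CompactlySupportedContinuousMap.continuousMapEquiv f)
  refine ⟨RealRMK.rieszMeasure Λ, inferInstance, fun h0 => ?_, fun f m hm => ?_⟩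
  · have := hint 1
    rw [h0, integral_zero_measure, hL1'] at this
    linarith
  · rw [hint]
    exact (hL2 f).trans (csInf_le (bddBelow_dominatingMasses _) hm)

/-! ### Frostman measures -/

lemma exists_rpow_mul_exp_neg_le {t : ℝ} (ht : 0 < t) :
    ∃ B : ℝ, 0 < B ∧ ∀ q : ℝ, 0 ≤ q → q ^ t * Real.exp (-Real.pi * q ^ 2) ≤ B := by
  refine ⟨1 + (⌈t⌉₊.factorial : ℝ), by positivity, fun q hq => ?_⟩
  have hf : (0 : ℝ) < ⌈t⌉₊.factorial := by exact_mod_cast Nat.factorial_pos _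
  rcases le_total q 1 with h | h
  · have h1 : q ^ t ≤ 1 := Real.rpow_le_one hq h ht.le
    have h2 : Real.exp (-Real.pi * q ^ 2) ≤ 1 :=
      Real.exp_le_one_iff.2 (by nlinarith [Real.pi_pos, sq_nonneg q])
    have h3 := mul_le_mul h1 h2 (Real.exp_pos _).le zero_le_one
    linarith
  · have h1 : q ^ t ≤ (Real.pi * q ^ 2) ^ ⌈t⌉₊ := by
      calc q ^ t ≤ q ^ (⌈t⌉₊ : ℝ) := Real.rpow_le_rpow_of_exponent_le h (Nat.le_ceil t)
        _ = q ^ ⌈t⌉₊ := Real.rpow_natCast _ _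
        _ ≤ _ := by
          refine pow_le_pow_left₀ hq ?_ _
          nlinarith [Real.pi_gt_three]
    have h2 := Real.pow_div_factorial_le_exp (Real.pi * q ^ 2) (by positivity) ⌈t⌉₊
    rw [div_le_iff₀ hf] at h2
    rw [neg_mul, Real.exp_neg, ← div_eq_mul_inv, div_le_iff₀ (Real.exp_pos _)]
    have := Real.exp_pos (Real.pi * q ^ 2)
    nlinarith

lemma exists_gaussKernel_le {t : ℝ} (ht : 0 < t) :
    ∃ B : ℝ, 0 < B ∧ ∀ {V : Type*} [NormedAddCommGroup V] {r : ℝ} (_ : 0 < r) (z : V),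
      ENNReal.ofReal (gaussKernel r z) ≤ ENNReal.ofReal (B * r ^ t) * ‖z‖ₑ ^ (-t) := by
  obtain ⟨B, hB, h⟩ := exists_rpow_mul_exp_neg_le ht
  refine ⟨B, hB, fun {V} _ r hr z => ?_⟩
  have hBr : 0 < B * r ^ t := by positivity
  rcases eq_or_ne z 0 with rfl | hz
  · rw [enorm_zero, ENNReal.zero_rpow_of_neg (by linarith), ENNReal.mul_top]
    · exact le_top
    · simpa using hBr
  · have hz' : 0 < ‖z‖ := norm_pos_iff.2 hz
    rw [← ofReal_norm, ENNReal.ofReal_rpow_of_pos hz', ← ENNReal.ofReal_mul hBr.le]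
    refine ENNReal.ofReal_le_ofReal ?_
    have h1 := h (‖z‖ / r) (by positivity)
    rw [Real.div_rpow hz'.le hr.le, div_mul_eq_mul_div, div_le_iff₀ (by positivity)] at h1
    rw [Real.rpow_neg hz'.le, ← div_eq_mul_inv, le_div_iff₀ (by positivity), gaussKernel,
      mul_comm, mul_div_assoc, ← div_pow]
    exact h1

/-- **Frostman's lemma**, for Gaussian energies. -/
theorem exists_measure_gaussEnergy_le {V : Type*} [NormedAddCommGroup V] [NormedSpace ℝ V]
    [SecondCountableTopology V] [MeasurableSpace V] [BorelSpace V] {t t' : ℝ} (ht : 0 < t)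
    (htt : t < t') {K : Set V} (hK : IsCompact K) (hH : Measure.hausdorffMeasure t' K ≠ 0) :
    ∃ ν : Measure V, IsFiniteMeasure ν ∧ ν ≠ 0 ∧ ν Kᶜ = 0 ∧ ∃ C : ℝ≥0∞, C ≠ ∞ ∧
      ∀ r : ℝ, 0 < r → gaussEnergy ν r ≤ C * ENNReal.ofReal (r ^ t) := by
  have : CompactSpace K := isCompact_iff_compactSpace.1 hK
  let k : K → V → ℝ≥0∞ := fun x y => ‖(x : V) - y‖ₑ ^ (-t)
  -- Were there dominating measures of arbitrarily small mass, `K` would be null for the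
  -- `t'`-dimensional Hausdorff measure.
  obtain ⟨ε, hε, hlow⟩ : ∃ ε : ℝ≥0∞, ε ≠ 0 ∧ ∀ σ : Measure V,
      (∀ x ∈ K, 1 ≤ ∫⁻ y, ‖x - y‖ₑ ^ (-t) ∂σ) → ε ≤ σ Set.univ := by
    by_contra! hcon
    refine hH (hausdorffMeasure_eq_zero_of_potential ht htt K fun ε hε => ?_)
    obtain ⟨σ, h1, h2⟩ := hcon ε hε
    exact ⟨σ, h2.le, h1⟩
  have hdirac : ∀ (f : K → ℝ) (y : V) (B : ℝ), 0 ≤ B →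
      (∀ x : K, ENNReal.ofReal (f x) ≤ ENNReal.ofReal B * ‖(x : V) - y‖ₑ ^ (-t)) →
      B ∈ dominatingMasses k f := fun f y B hB h => by
    refine ⟨ENNReal.ofReal B • Measure.dirac y, Measure.smul_finite _ ENNReal.ofReal_ne_top, ?_,
      fun x => ?_⟩
    · simp [measureReal_ennreal_smul_apply, ENNReal.toReal_ofReal hB]
    · rw [lintegral_smul_measure, lintegral_dirac, smul_eq_mul]
      exact h x
  have hne : (dominatingMasses k (fun _ => 1)).Nonempty := by
    obtain ⟨R, hR⟩ := hK.isBounded.exists_norm_le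
    -- A multiple of the Dirac mass at `0` dominates `1` on the bounded set `K`; the maximum keeps
    -- the radius positive.
    set R' := max R 1 with hR'
    have hR0 : 0 < R' := lt_max_of_lt_right one_pos
    refine ⟨_, hdirac _ 0 (R' ^ t) (by positivity) fun x => ?_⟩
    rw [sub_zero]
    have h1 : ‖(x : V)‖ₑ ≤ ENNReal.ofReal R' := by
      rw [← ofReal_norm]
      exact ENNReal.ofReal_le_ofReal ((hR x x.2).trans (le_max_left _ _))
    have h2 : ENNReal.ofReal R' ^ (-t) ≤ ‖(x : V)‖ₑ ^ (-t) := by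
      rw [ENNReal.rpow_neg, ENNReal.rpow_neg]
      exact ENNReal.inv_le_inv.2 (ENNReal.rpow_le_rpow h1 ht.le)
    refine le_trans (le_of_eq ?_) (mul_le_mul_right h2 _)
    rw [ENNReal.ofReal_rpow_of_pos hR0, ← ENNReal.ofReal_mul (by positivity),
      ← Real.rpow_add hR0]
    simp
  have hεtop : ε ≠ ∞ := by
    obtain ⟨_, σ, hσ, _, h⟩ := hne
    exact ne_top_of_le_ne_top (measure_ne_top σ Set.univ)
      (hlow σ fun x hx => by simpa using h ⟨x, hx⟩)
  obtain ⟨ν, hν, hν0, hνint⟩ := exists_measure_integral_le_of_potential k hne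
    (ENNReal.toReal_pos hε hεtop) (by
      rintro _ ⟨σ, hσ, rfl, h⟩
      exact ENNReal.toReal_mono (measure_ne_top _ _)
        (hlow σ fun x hx => by simpa using h ⟨x, hx⟩))
  obtain ⟨B, hB, hgauss⟩ := exists_gaussKernel_le ht
  have hval : Measurable (Subtype.val : K → V) := measurable_subtype_coe
  refine ⟨ν.map Subtype.val, inferInstance, ?_, ?_, ENNReal.ofReal B * ν Set.univ,
    ENNReal.mul_ne_top ENNReal.ofReal_ne_top (measure_ne_top _ _), fun r hr => ?_⟩
  · rwa [Ne, Measure.map_eq_zero_iff hval.aemeasurable]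
  · rw [Measure.map_apply hval hK.isClosed.measurableSet.compl]
    simp
  · have h1 : ∀ x : V, ∫⁻ y, ENNReal.ofReal (gaussKernel r (x - y)) ∂(ν.map Subtype.val) ≤
        ENNReal.ofReal (B * r ^ t) := fun x => by
      rw [lintegral_map (by fun_prop) hval]
      let f : C(K, ℝ) := ⟨fun y => gaussKernel r (x - y), by fun_prop⟩
      -- The Gaussian centred at `x` is dominated by the potential of `B * r ^ t` times the Dirac
      -- mass at `x`, so duality bounds its `ν`-integral uniformly in `x`.
      have hf : B * r ^ t ∈ dominatingMasses k f := by
        refine hdirac _ x _ (by positivity) fun y => ?_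
        rw [← enorm_neg, neg_sub]
        exact hgauss hr _
      have h2 : ∫⁻ y : K, ENNReal.ofReal (gaussKernel r (x - y)) ∂ν =
          ENNReal.ofReal (∫ y, f y ∂ν) := by
        rw [ofReal_integral_eq_lintegral_ofReal]
        · rfl
        · exact f.continuous.integrable_of_hasCompactSupport (HasCompactSupport.of_compactSpace f)
        · filter_upwards with y using gaussKernel_nonneg _ _
      rw [h2]
      exact ENNReal.ofReal_le_ofReal (hνint f _ hf)
    refine (lintegral_mono h1).trans (le_of_eq ?_)
    rw [lintegral_const, Measure.map_apply hval MeasurableSet.univ, Set.preimage_univ,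
      ENNReal.ofReal_mul hB.le]
    ring

/-! ### Assembling the dimension inequality -/

lemma gaussEnergy_le_measure_univ_sq {V : Type*} [NormedAddCommGroup V] [MeasurableSpace V]
    (μ : Measure V) (r : ℝ) : gaussEnergy μ r ≤ μ Set.univ * μ Set.univ := by
  unfold gaussEnergy
  calc _ ≤ ∫⁻ _, ∫⁻ _, 1 ∂μ ∂μ := lintegral_mono fun x => lintegral_mono fun y =>
        ENNReal.ofReal_le_one.2 (gaussKernel_le_one _ _)
    _ = _ := by simp

/-- The exponent `t = 0` is admitted, with a Dirac mass as witness, so that sets `Z` of dimension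
zero are covered. -/
lemma exists_measure_gaussEnergy_le_of_lt_dimH {d : ℕ} {Z : Set (EuclideanSpace ℝ (Fin d))}
    (hZ : IsCompact Z) (hZne : Z.Nonempty) {t : ℝ≥0} (ht : t = 0 ∨ (t : ℝ≥0∞) < dimH Z) :
    ∃ ν : Measure (EuclideanSpace ℝ (Fin d)), IsFiniteMeasure ν ∧ ν ≠ 0 ∧ ν Zᶜ = 0 ∧
      ∃ C : ℝ≥0∞, C ≠ ∞ ∧
        ∀ r : ℝ, 0 < r → gaussEnergy ν r ≤ C * ENNReal.ofReal (r ^ (t : ℝ)) := by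
  rcases eq_or_ne t 0 with rfl | h0
  · obtain ⟨z, hz⟩ := hZne
    refine ⟨Measure.dirac z, inferInstance, Measure.dirac_ne_zero, ?_, 1, by simp, fun r _ => ?_⟩
    · simp [hz]
    · simpa using gaussEnergy_le_measure_univ_sq (Measure.dirac z) r
  · obtain ⟨t', h1, h2⟩ := ENNReal.lt_iff_exists_nnreal_btwn.1 (ht.resolve_left h0)
    refine exists_measure_gaussEnergy_le (by positivity) (t' := t')
      (by exact_mod_cast h1) hZ ?_
    rw [hausdorffMeasure_of_lt_dimH h2]
    simp

lemma conv_compl_add_eq_zero {V : Type*} [NormedAddCommGroup V] [MeasurableSpace V]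
    [BorelSpace V] [SecondCountableTopology V] {μ ν : Measure V} [SFinite μ] [SFinite ν]
    {A B : Set V} (hA : IsCompact A) (hB : IsCompact B)
    (hμ : μ Aᶜ = 0) (hν : ν Bᶜ = 0) : (μ ∗ ν) (A + B)ᶜ = 0 := by
  have hAB : MeasurableSet (A + B)ᶜ := (hA.add hB).isClosed.measurableSet.compl
  rw [Measure.conv, Measure.map_apply measurable_add hAB]
  refine measure_mono_null (t := Aᶜ ×ˢ Set.univ ∪ Set.univ ×ˢ Bᶜ) (fun p hp => ?_)
    (measure_union_null ?_ ?_)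
  · by_contra hcon
    simp only [Set.mem_union, Set.mem_prod, Set.mem_compl_iff, Set.mem_univ, and_true, true_and,
      not_or, not_not] at hcon
    exact hp (Set.add_mem_add hcon.1 hcon.2)
  · rw [Measure.prod_prod, hμ, zero_mul]
  · rw [Measure.prod_prod, hν, mul_zero]

lemma conv_ne_zero {V : Type*} [NormedAddCommGroup V] [MeasurableSpace V]
    [BorelSpace V] [SecondCountableTopology V] {μ ν : Measure V} [SFinite μ] [SFinite ν]
    (hμ : μ ≠ 0) (hν : ν ≠ 0) : μ ∗ ν ≠ 0 := by
  rw [Measure.conv, Ne, Measure.map_eq_zero_iff measurable_add.aemeasurable,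
    ← Measure.measure_univ_eq_zero, ← Set.univ_prod_univ, Measure.prod_prod, mul_eq_zero,
    Measure.measure_univ_eq_zero, Measure.measure_univ_eq_zero, not_or]
  exact ⟨hμ, hν⟩

lemma add_le_dimH_add {d : ℕ} {A Z : Set (EuclideanSpace ℝ (Fin d))} (hA : IsCompact A)
    (hZ : IsCompact Z) (hZne : Z.Nonempty) {μ : Measure (EuclideanSpace ℝ (Fin d))}
    [IsFiniteMeasure μ] (hμ0 : μ ≠ 0) (hμA : μ Aᶜ = 0) {s t : ℝ≥0} {C : ℝ} (hs : 0 < s)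
    (hμ : ∀ ξ, ‖measureFourier μ ξ‖ ^ 2 * ‖ξ‖ ^ (s : ℝ) ≤ C)
    (ht : t = 0 ∨ (t : ℝ≥0∞) < dimH Z) (hst : s + t < d) {v : ℝ≥0} (hv : v < s + t) :
    (v : ℝ≥0∞) ≤ dimH (A + Z) := by
  rcases eq_or_ne v 0 with rfl | hv0
  · simp
  obtain ⟨ν, _, hν0, hνZ, D, hD, hνD⟩ := exists_measure_gaussEnergy_le_of_lt_dimH hZ hZne ht
  obtain ⟨C', hC', h⟩ := gaussEnergy_conv_le μ ν (s := s) (t := t) (by exact_mod_cast hs) t.2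
    (by exact_mod_cast hst) hμ hD hνD
  exact le_dimH_of_gaussEnergy_le (μ ∗ ν) (conv_ne_zero hμ0 hν0)
    (conv_compl_add_eq_zero hA hZ hμA hνZ) (pos_iff_ne_zero.2 hv0) (by exact_mod_cast hv) hC' h

/-- For `‖ξ‖ ≤ 1` the total mass bounds the transform; for `‖ξ‖ ≥ 1` a smaller exponent weakens the
estimate. -/
lemma decay_of_le {d : ℕ} {μ : Measure (EuclideanSpace ℝ (Fin d))} [IsFiniteMeasure μ]
    {s s' C : ℝ} (hs' : 0 ≤ s') (hss : s' ≤ s)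
    (h : ∀ ξ, ‖measureFourier μ ξ‖ ^ 2 * ‖ξ‖ ^ s ≤ C) (ξ : EuclideanSpace ℝ (Fin d)) :
    ‖measureFourier μ ξ‖ ^ 2 * ‖ξ‖ ^ s' ≤ max (μ.real Set.univ ^ 2) C := by
  rcases le_total ‖ξ‖ 1 with h1 | h1
  · refine le_trans ?_ (le_max_left _ _)
    calc _ ≤ μ.real Set.univ ^ 2 * 1 :=
          mul_le_mul (pow_le_pow_left₀ (norm_nonneg _) (norm_measureFourier_le μ ξ) 2)
            (Real.rpow_le_one (norm_nonneg _) h1 hs') (by positivity) (by positivity)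
      _ = _ := mul_one _
  · refine le_trans ?_ (le_max_right _ _)
    exact (mul_le_mul_of_nonneg_left (Real.rpow_le_rpow_of_exponent_le h1 hss)
      (by positivity)).trans (h ξ)

lemma dimH_le_dimH_add {V : Type*} [NormedAddCommGroup V] {A Z : Set V} (hA : A.Nonempty) :
    dimH Z ≤ dimH (A + Z) := by
  obtain ⟨a, ha⟩ := hA
  rw [← (isometry_add_left a).dimH_image Z]
  refine dimH_mono ?_
  rintro _ ⟨z, hz, rfl⟩
  exact Set.add_mem_add ha hz

theorem dimF_add_dimH_le {d : ℕ} {A Z : Set (EuclideanSpace ℝ (Fin d))} (hA : IsCompact A)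
    (hZ : IsCompact Z) (hAne : A.Nonempty) (hZne : Z.Nonempty) (hd : dimF A + dimH Z ≤ d) :
    dimF A + dimH Z ≤ dimH (A + Z) := by
  rcases eq_or_ne (dimF A) 0 with h0 | h0
  · rw [h0, zero_add]
    exact dimH_le_dimH_add hAne
  have hFtop : dimF A ≠ ∞ := ne_top_of_le_ne_top (by simp) (le_self_add.trans hd)
  have hHtop : dimH Z ≠ ∞ := ne_top_of_le_ne_top (by simp) (le_add_self.trans hd)
  obtain ⟨F, hF⟩ : ∃ F : ℝ≥0, (F : ℝ≥0∞) = dimF A := WithTop.ne_top_iff_exists.1 hFtop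
  obtain ⟨H, hH⟩ : ∃ H : ℝ≥0, (H : ℝ≥0∞) = dimH Z := WithTop.ne_top_iff_exists.1 hHtop
  have hF0 : 0 < F := by
    rw [← hF] at h0
    exact pos_iff_ne_zero.2 (by exact_mod_cast h0)
  refine ENNReal.le_of_forall_nnreal_lt fun v hv => ?_
  rw [← hF, ← hH, ← ENNReal.coe_add, ENNReal.coe_lt_coe] at hv
  rw [← hF, ← hH] at hd
  have hd' : F + H ≤ d := by exact_mod_cast hd
  -- Strictness `s' < F` forces `s' + t < d` even when `F + H = d`. If `F ≤ v` then `H > 0` and `t`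
  -- is taken strictly between `v - F` and `H`; otherwise `t = 0` suffices.
  obtain ⟨s', t, hs', hs'F, ht, htH, hvst⟩ : ∃ s' t : ℝ≥0, 0 < s' ∧ s' < F ∧
      (t = 0 ∨ t < H) ∧ t ≤ H ∧ v < s' + t := by
    rcases le_or_gt F v with h | h
    · have hvF : v - F < H := by
        rw [tsub_lt_iff_left h]
        exact hv
      obtain ⟨t, ht1, ht2⟩ := exists_between hvF
      have hv' : v < F + t := (tsub_lt_iff_left h).1 ht1
      have h3 : max (v - t) 0 < F := max_lt (by
        rcases le_total t v with h4 | h4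
        · rw [tsub_lt_iff_right h4]
          exact hv'
        · rw [tsub_eq_zero_of_le h4]
          exact hF0) hF0
      obtain ⟨s', h5, h6⟩ := exists_between h3
      refine ⟨s', t, lt_of_le_of_lt (le_max_right _ _) h5, h6, Or.inr ht2, ht2.le, ?_⟩
      exact lt_add_of_tsub_lt_right (lt_of_le_of_lt (le_max_left _ _) h5)
    · obtain ⟨s', h1, h2⟩ := exists_between h
      exact ⟨s', 0, lt_of_le_of_lt zero_le h1, h2, Or.inl rfl, zero_le, by simpa using h1⟩
  obtain ⟨_, ⟨s, rfl, -, μ, ⟨hμ0, hμfin, -, hμA⟩, C, hC⟩, hss⟩ :=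
    lt_sSup_iff.1 (show (s' : ℝ≥0∞) < dimF A by rw [← hF]; exact_mod_cast hs'F)
  refine add_le_dimH_add hA hZ hZne hμ0
    (measure_mono_null (Set.compl_subset_compl.2 hμA) Measure.measure_compl_support) hs'
    (decay_of_le s'.2 (by exact_mod_cast hss.le) hC) ?_
    (lt_of_lt_of_le (add_lt_add_of_lt_of_le hs'F htH) hd') hvst
  rw [← hH]
  exact ht.imp id fun h => by exact_mod_cast h

theorem mainTheorem3 (d : ℕ) (R : Set ℝ) (Y Z : Set (EuclideanSpace ℝ (Fin d)))
    (hR : R ⊆ Set.Ioi 0) (hRc : IsCompact R) (hYc : IsCompact Y) (hZc : IsCompact Z)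
    (hRne : R.Nonempty) (hYne : Y.Nonempty) (hZne : Z.Nonempty)
    (hM : max (dimF (R • Y) + dimH Z) (dimH (R • Y) + dimF Z) ≤ (d : ℝ≥0∞)) :
    max (dimF (R • Y) + dimH Z) (dimH (R • Y) + dimF Z) ≤ dimH (R • Y + Z) := by
  have hA : IsCompact (R • Y) := hRc.smul_set hYc
  have hAne : (R • Y).Nonempty := hRne.smul hYne
  rw [max_le_iff] at hM
  refine max_le (dimF_add_dimH_le hA hZc hAne hZne hM.1) ?_
  rw [add_comm, add_comm (R • Y)]
  exact dimF_add_dimH_le hZc hA hZne hAne (by rw [add_comm]; exact hM.2)
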